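/- Let $r>1$ and let $\vec G=(G_0,G_1)$ be the couple of real Hilbert spaces on $\mathbb R^2$ with norms $\|(x,y)\|_{G_0}=\sqrt{x^2+y^2}$ and $\|(x,y)\|_{G_1}=\sqrt{x^2+ry^2}$. For a Banach couple $\vec A=(A_0,A_1)$, $t>0$ and $u\in A_0+A_1$ put $K(t,u;\vec A)=\inf\{\|u_0\|_{A_0}+t\|u_1\|_{A_1}: u=u_0+u_1\}$. The $K$-divisibility constant $\gamma(\vec A)$ is the infimum of all constants $C\ge 0$ with the following property: whenever $u\in A_0+A_1$ and $(\varphi_n)_{n\ge1}$ are positive concave functions on $(0,\infty)$ with $\sum_n\varphi_n(1)<\infty$ and $K(t,u;\vec A)\le\sum_n\varphi_n(t)$ for all $t>0$, there are $u_n\in A_0+A_1$ with $u=\sum_n u_n$ (convergence in $A_0+A_1$) and $K(t,u_n;\vec A)\le C\varphi_n(t)$ for all $t>0$ and all $n$. For a real number $a$ let $(b,c)=(\cos a,\sin a)$ and define weights on $(0,\infty)$ by $$w_j(t)=\frac{\dfrac{b^2}{(1+t)^3}+\dfrac{r^2c^2}{(1+rt)^3}}{\sqrt{\dfrac{b^2}{(1+t)^2}+\dfrac{r^{2-j}c^2}{(1+rt)^2}}},\qquad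 j=0,1.$$ Let $\vec P=(L^1_{w_0},L^1_{w_1})$ be the couple of weighted $L^1$ spaces on $(0,\infty)$ with Lebesgue measure, where $\|h\|_{L^1_{w_j}}=\int_0^\infty|h|\,w_j\,dt$, and let $f$ be the constant function $1$ on $(0,\infty)$. Let $c_a$ be the infimum of $\|T\|_{\vec P\to\vec G}=\max_{j=0,1}\|T\|_{L^1_{w_j}\to G_j}$ over all bounded linear operators $T:\vec P\to\vec G$ with $Tf=(b,c)$. Then $c_a<\dfrac{1+\sqrt r}{2}$ for every real $a$, and $$\gamma(\vec G)<\min\left\{\frac{1+\sqrt r}{2},\sqrt2\right\}.$$ -/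

import Mathlib

open MeasureTheory Filter Topology Set
open scoped ENNReal NNReal

noncomputable section

namespace KDiv

/-- A real Banach couple `(A₀, A₁)`, given inside a real vector space `V` by its two extended
norms: `nrm j x` is the norm of `x` in `A_j` if `x ∈ A_j`, and `∞` otherwise.  The field
`separated` says that `‖·‖_{A₀ + A₁}` is a norm, i.e. that both spaces are continuously embedded
in one Hausdorff topological vector space; `complete` says that `A₀` and `A₁` are complete. -/
structure BanachCouple (V : Type*) [AddCommGroup V] [Module ℝ V] where
  nrm : Fin 2 → V → ℝ≥0∞
  nrm_add_le : ∀ j x y, nrm j (x + y) ≤ nrm j x + nrm j y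
  nrm_smul : ∀ j (c : ℝ) x, nrm j (c • x) = ‖c‖ₑ * nrm j x
  separated : ∀ x, (∀ ε : ℝ≥0∞, 0 < ε → ∃ x₀ x₁, x₀ + x₁ = x ∧ nrm 0 x₀ + nrm 1 x₁ < ε) → x = 0
  complete : ∀ (j : Fin 2) (u : ℕ → V), (∀ n, nrm j (u n) ≠ ∞) →
    (∀ ε : ℝ≥0∞, 0 < ε → ∃ N, ∀ m ≥ N, ∀ n ≥ N, nrm j (u m - u n) < ε) →
    ∃ x, Tendsto (fun n => nrm j (u n - x)) atTop (𝓝 0)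

namespace BanachCouple

variable {V W : Type*} [AddCommGroup V] [Module ℝ V] [AddCommGroup W] [Module ℝ W]

/-- Peetre's functional `K(t, x; A₀, A₁) = inf {‖x₀‖_{A₀} + t ‖x₁‖_{A₁} : x = x₀ + x₁}`. -/
def K (A : BanachCouple V) (t : ℝ) (x : V) : ℝ≥0∞ :=
  ⨅ (x₀ : V) (x₁ : V) (_ : x₀ + x₁ = x), A.nrm 0 x₀ + ENNReal.ofReal t * A.nrm 1 x₁

lemma nrm_zero (A : BanachCouple V) (j : Fin 2) : A.nrm j 0 = 0 := by
  have h := A.nrm_smul j 0 0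
  simpa using h

/-- The sum space `A₀ + A₁`. -/
def sum (A : BanachCouple V) : Submodule ℝ V where
  carrier := {x | ∃ x₀ x₁, x₀ + x₁ = x ∧ A.nrm 0 x₀ ≠ ∞ ∧ A.nrm 1 x₁ ≠ ∞}
  add_mem' := by
    rintro x y ⟨x₀, x₁, rfl, h₀, h₁⟩ ⟨y₀, y₁, rfl, k₀, k₁⟩
    refine ⟨x₀ + y₀, x₁ + y₁, by abel, ?_, ?_⟩
    · exact ne_top_of_le_ne_top (ENNReal.add_ne_top.2 ⟨h₀, k₀⟩) (A.nrm_add_le 0 _ _)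
    · exact ne_top_of_le_ne_top (ENNReal.add_ne_top.2 ⟨h₁, k₁⟩) (A.nrm_add_le 1 _ _)
  zero_mem' := ⟨0, 0, by simp, by simp [nrm_zero], by simp [nrm_zero]⟩
  smul_mem' := by
    rintro c x ⟨x₀, x₁, rfl, h₀, h₁⟩
    refine ⟨c • x₀, c • x₁, (smul_add _ _ _).symm, ?_, ?_⟩
    · rw [A.nrm_smul]; exact ENNReal.mul_ne_top enorm_ne_top h₀
    · rw [A.nrm_smul]; exact ENNReal.mul_ne_top enorm_ne_top h₁

/-- The norm `max_j ‖T‖_{A_j → B_j}` of a linear operator `T : A₀ + A₁ → B₀ + B₁`, equal to `∞`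
if `T` does not map each `A_j` boundedly into `B_j`. -/
def opNorm (A : BanachCouple V) (B : BanachCouple W) (T : A.sum →ₗ[ℝ] B.sum) : ℝ≥0∞ :=
  sInf {C : ℝ≥0∞ | ∀ (j : Fin 2) (x : A.sum), A.nrm j x ≠ ∞ → B.nrm j (T x) ≤ C * A.nrm j x}

/-- The bounded linear operators `T` from the couple `P` to the couple `A` with `T f = a`. -/
def operatorsTaking (P : BanachCouple V) (A : BanachCouple W) (f : V) (a : W) :
    Set (P.sum →ₗ[ℝ] A.sum) :=
  {T | opNorm P A T < ∞ ∧ ∃ hf : f ∈ P.sum, (T ⟨f, hf⟩ : W) = a}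

/-- `C` is an admissible constant in the `K`-divisibility theorem for `A` (with infinitely many
summands): whenever `K(t, a; A) ≤ ∑ φ_n(t)` for all `t > 0`, with positive concave functions `φ_n`
on `(0, ∞)` such that `∑ φ_n(1) < ∞`, there are `a_n` with `a = ∑ a_n`, convergent in `A₀ + A₁`,
and `K(t, a_n; A) ≤ C φ_n(t)` for all `t > 0` and all `n`. -/
def IsKDivisibilityConst (A : BanachCouple V) (C : ℝ≥0) : Prop :=
  ∀ a ∈ A.sum, ∀ φ : ℕ → ℝ → ℝ,
    (∀ n, ConcaveOn ℝ (Ioi 0) (φ n)) → (∀ n, ∀ t > 0, 0 < φ n t) → Summable (fun n => φ n 1) →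
    (∀ t > 0, A.K t a ≤ ∑' n, ENNReal.ofReal (φ n t)) →
    ∃ u : ℕ → V, (∀ n, u n ∈ A.sum) ∧
      Tendsto (fun N => A.K 1 (a - ∑ n ∈ Finset.range N, u n)) atTop (𝓝 0) ∧
      ∀ n, ∀ t > 0, A.K t (u n) ≤ C * ENNReal.ofReal (φ n t)

/-- The `K`-divisibility constant `γ(A)`: the infimum of all admissible constants. -/
def gamma (A : BanachCouple V) : ℝ≥0∞ :=
  ⨅ (C : ℝ≥0) (_ : A.IsKDivisibilityConst C), (C : ℝ≥0∞)

end BanachCouple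

/-- The norm `√(x² + c y²)` as the Euclidean norm of `(x, √c y)`. -/
lemma enorm_sqrt_eq (c : ℝ) (hc : 0 ≤ c) (v : ℝ × ℝ) :
    ENNReal.ofReal (√(v.1 ^ 2 + c * v.2 ^ 2)) = ‖(!₂[v.1, √c * v.2] : EuclideanSpace ℝ (Fin 2))‖ₑ := by
  rw [← ofReal_norm, EuclideanSpace.norm_eq]
  simp [Fin.sum_univ_two, mul_pow, Real.sq_sqrt hc]

/-- The two-dimensional Hilbert couple `G`: on `ℝ²`, `‖(x, y)‖_{G₀} = √(x² + y²)` and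
`‖(x, y)‖_{G₁} = √(x² + r y²)`. -/
def hilbertCouple (r : ℝ) (hr : 0 < r) : BanachCouple (ℝ × ℝ) where
  nrm j v := ENNReal.ofReal (√(v.1 ^ 2 + r ^ (j : ℕ) * v.2 ^ 2))
  nrm_add_le := by
    intro j x y
    have hc : 0 ≤ r ^ (j : ℕ) := by positivity
    simp only [enorm_sqrt_eq _ hc]
    refine le_trans (le_of_eq ?_) (enorm_add_le _ _)
    congr 1
    ext i
    fin_cases i <;> simp [mul_add]
  nrm_smul := by
    intro j c x
    have hc : 0 ≤ r ^ (j : ℕ) := by positivity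
    simp only [enorm_sqrt_eq _ hc]
    rw [← enorm_smul]
    congr 1
    ext i
    fin_cases i <;> simp [mul_left_comm]
  separated := by
    intro x hx
    have key : ∀ δ : ℝ, 0 < δ → |x.1| ≤ δ ∧ min 1 (√r) * |x.2| ≤ δ := by
      intro δ hδ
      obtain ⟨y, z, rfl, h⟩ := hx (ENNReal.ofReal δ) (by simpa using hδ)
      rw [← ENNReal.ofReal_add (Real.sqrt_nonneg _) (Real.sqrt_nonneg _)] at h
      have h := (ENNReal.ofReal_lt_ofReal_iff hδ).1 h
      simp only [Fin.val_zero, pow_zero, one_mul, Fin.val_one, pow_one] at h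
      have h1 : |y.1| ≤ √(y.1 ^ 2 + y.2 ^ 2) := Real.abs_le_sqrt (by nlinarith [sq_nonneg y.2])
      have h2 : |y.2| ≤ √(y.1 ^ 2 + y.2 ^ 2) := Real.abs_le_sqrt (by nlinarith [sq_nonneg y.1])
      have h3 : |z.1| ≤ √(z.1 ^ 2 + r * z.2 ^ 2) :=
        Real.abs_le_sqrt (by nlinarith [mul_nonneg hr.le (sq_nonneg z.2)])
      have h4 : √r * |z.2| ≤ √(z.1 ^ 2 + r * z.2 ^ 2) := by
        apply Real.le_sqrt_of_sq_le
        rw [mul_pow, Real.sq_sqrt hr.le, sq_abs]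
        nlinarith [sq_nonneg z.1]
      constructor
      · calc |(y + z).1| ≤ |y.1| + |z.1| := abs_add_le _ _
          _ ≤ δ := by linarith
      · have hm : 0 ≤ min 1 (√r) := le_min zero_le_one (Real.sqrt_nonneg _)
        calc min 1 (√r) * |(y + z).2| ≤ min 1 (√r) * (|y.2| + |z.2|) := by
              gcongr; exact abs_add_le _ _
          _ = min 1 (√r) * |y.2| + min 1 (√r) * |z.2| := by ring
          _ ≤ 1 * |y.2| + √r * |z.2| := by
              gcongr
              · exact min_le_left _ _
              · exact min_le_right _ _
          _ ≤ δ := by linarith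
    have hm : 0 < min 1 (√r) := lt_min zero_lt_one (Real.sqrt_pos.2 hr)
    ext
    · exact abs_nonpos_iff.1 (le_of_forall_pos_le_add fun δ hδ => by simpa using (key δ hδ).1)
    · have : min 1 (√r) * |x.2| ≤ 0 :=
        le_of_forall_pos_le_add fun δ hδ => by simpa using (key δ hδ).2
      exact abs_nonpos_iff.1 (by by_contra! h; nlinarith [mul_pos hm h])
  complete := by
    intro j u _ hu
    have hcp : 0 < r ^ (j : ℕ) := by positivity
    simp only [enorm_sqrt_eq _ hcp.le] at hu ⊢
    let L : ℝ × ℝ → EuclideanSpace ℝ (Fin 2) := fun v => !₂[v.1, √(r ^ (j : ℕ)) * v.2]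
    have hL : ∀ v w, L (v - w) = L v - L w := by
      intro v w
      ext i
      fin_cases i <;> simp [L, mul_sub]
    have hc : CauchySeq (fun n => L (u n)) := by
      rw [EMetric.cauchySeq_iff]
      intro ε hε
      obtain ⟨N, hN⟩ := hu ε hε
      refine ⟨N, fun m hm n hn => ?_⟩
      rw [edist_eq_enorm_sub, ← hL]
      exact hN m hm n hn
    obtain ⟨y, hy⟩ := cauchySeq_tendsto_of_complete hc
    refine ⟨(y 0, y 1 / √(r ^ (j : ℕ))), ?_⟩
    have hLy : L (y 0, y 1 / √(r ^ (j : ℕ))) = y := by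
      have : √(r ^ (j : ℕ)) ≠ 0 := (Real.sqrt_pos.2 hcp).ne'
      ext i
      fin_cases i
      · simp [L]
      · simp only [L]
        simp
        field_simp
    have h2 := tendsto_iff_edist_tendsto_0.1 hy
    refine h2.congr fun n => ?_
    rw [edist_eq_enorm_sub]
    conv_lhs => rw [← hLy]
    rw [← hL]

variable {Ω : Type*} [MeasurableSpace Ω]

lemma weighted_lintegral_eq (μ : Measure Ω) (w : Ω → ℝ) (hw : Measurable w) (f : Ω → ℝ) :
    ∫⁻ s, ‖f s‖ₑ * ENNReal.ofReal (w s) ∂μ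
      = eLpNorm f 1 (μ.withDensity fun s => ENNReal.ofReal (w s)) := by
  rw [eLpNorm_one_eq_lintegral_enorm, lintegral_withDensity_eq_lintegral_mul_non_measurable μ
    hw.ennreal_ofReal (by simp)]
  simp [mul_comm]

/-- The couple `(L¹_{w₀}(μ), L¹_{w₁}(μ))` of weighted `L¹` spaces, for weights that are positive
almost everywhere, with `‖f‖_{L¹_w} = ∫ |f| w dμ`. -/
def weightedL1Couple (μ : Measure Ω) (w : Fin 2 → Ω → ℝ) (hw : ∀ j, Measurable (w j))
    (hpos : ∀ j, ∀ᵐ s ∂μ, 0 < w j s) : BanachCouple (Ω →ₘ[μ] ℝ) where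
  nrm j f := ∫⁻ s, ‖f s‖ₑ * ENNReal.ofReal (w j s) ∂μ
  nrm_add_le := by
    intro j f g
    rw [← lintegral_add_left']
    · apply lintegral_mono_ae
      filter_upwards [AEEqFun.coeFn_add f g] with s hs
      rw [hs, ← add_mul]
      gcongr
      exact enorm_add_le _ _
    · exact f.aemeasurable.enorm.mul (hw j).ennreal_ofReal.aemeasurable
  nrm_smul := by
    intro j c f
    rw [← lintegral_const_mul'']
    · apply lintegral_congr_ae
      filter_upwards [AEEqFun.coeFn_smul c f] with s hs
      rw [hs, Pi.smul_apply, enorm_smul, mul_assoc]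
    · exact f.aemeasurable.enorm.mul (hw j).ennreal_ofReal.aemeasurable
  separated := by
    intro f hf
    have h0 : ∫⁻ s, ‖f s‖ₑ * ENNReal.ofReal (min (w 0 s) (w 1 s)) ∂μ = 0 := by
      refine le_antisymm (le_of_forall_gt fun ε hε => ?_) zero_le
      obtain ⟨g, h, rfl, hlt⟩ := hf ε hε
      refine lt_of_le_of_lt ?_ hlt
      rw [← lintegral_add_left']
      · apply lintegral_mono_ae
        filter_upwards [AEEqFun.coeFn_add g h] with s hs
        rw [hs]
        refine (mul_le_mul_left (enorm_add_le _ _) _).trans ?_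
        rw [add_mul]
        gcongr
        · exact min_le_left _ _
        · exact min_le_right _ _
      · exact g.aemeasurable.enorm.mul (hw 0).ennreal_ofReal.aemeasurable
    have h0 := (lintegral_eq_zero_iff' (f.aemeasurable.enorm.mul
      ((hw 0).min (hw 1)).ennreal_ofReal.aemeasurable)).1 h0
    apply AEEqFun.ext
    filter_upwards [h0, hpos 0, hpos 1, AEEqFun.coeFn_zero (μ := μ) (β := ℝ)] with s hs a b hz
    rw [hz]
    simpa [a, b, not_le.2 a, not_le.2 b] using hs
  complete := by
    intro j u hfin hu
    let d : Ω → ℝ≥0∞ := fun s => ENNReal.ofReal (w j s)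
    have hd : Measurable d := (hw j).ennreal_ofReal
    have hac : μ.withDensity d ≪ μ := withDensity_absolutelyContinuous μ d
    have hac' : μ ≪ μ.withDensity d := by
      refine withDensity_absolutelyContinuous' hd.aemeasurable ?_
      filter_upwards [hpos j] with s hs
      simpa [d] using hs
    simp only [weighted_lintegral_eq μ (w j) (hw j)] at hfin hu ⊢
    have hmem : ∀ n, MemLp (u n) 1 (μ.withDensity d) := fun n =>
      ⟨(u n).aestronglyMeasurable.mono_ac hac, (hfin n).lt_top⟩
    have hc : CauchySeq (fun n => (hmem n).toLp (u n)) := by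
      rw [EMetric.cauchySeq_iff]
      intro ε hε
      obtain ⟨N, hN⟩ := hu ε hε
      refine ⟨N, fun m hm n hn => ?_⟩
      rw [Lp.edist_toLp_toLp]
      refine lt_of_eq_of_lt (eLpNorm_congr_ae ?_) (hN m hm n hn)
      exact (hac.ae_eq (AEEqFun.coeFn_sub (u m) (u n))).symm
    obtain ⟨y, hy⟩ := cauchySeq_tendsto_of_complete hc
    have hym : AEStronglyMeasurable y μ := (Lp.aestronglyMeasurable y).mono_ac hac'
    refine ⟨AEEqFun.mk y hym, ?_⟩
    rw [tendsto_iff_edist_tendsto_0] at hy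
    refine hy.congr fun n => ?_
    rw [Lp.edist_def]
    apply eLpNorm_congr_ae
    filter_upwards [(hmem n).coeFn_toLp, hac.ae_eq (AEEqFun.coeFn_sub (u n) (AEEqFun.mk y hym)),
      hac.ae_eq (AEEqFun.coeFn_mk y hym)] with s h1 h2 h3
    rw [h2, Pi.sub_apply, Pi.sub_apply, h1, h3]

/-- The weights on `(0, ∞)` belonging to the point `(b, c) = (cos a, sin a)`:
`w_j(t) = (b²/(1+t)³ + r²c²/(1+rt)³) / √(b²/(1+t)² + r^{2-j}c²/(1+rt)²)`, for `j = 0, 1`. -/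
def hilbertWeight (r a : ℝ) (j : Fin 2) (t : ℝ) : ℝ :=
  (Real.cos a ^ 2 / (1 + t) ^ 3 + r ^ 2 * Real.sin a ^ 2 / (1 + r * t) ^ 3) /
    √(Real.cos a ^ 2 / (1 + t) ^ 2 + r ^ (2 - (j : ℕ)) * Real.sin a ^ 2 / (1 + r * t) ^ 2)

lemma measurable_hilbertWeight (r a : ℝ) (j : Fin 2) : Measurable (hilbertWeight r a j) := by
  unfold hilbertWeight
  fun_prop

lemma hilbertWeight_pos (r a : ℝ) (hr : 0 < r) (j : Fin 2) (t : ℝ) (ht : 0 < t) :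
    0 < hilbertWeight r a j t := by
  unfold hilbertWeight
  have h1 : 0 < 1 + t := by positivity
  have h2 : 0 < 1 + r * t := by positivity
  by_cases hb : Real.cos a = 0
  · have hs : 0 < Real.sin a ^ 2 := by
      have := Real.sin_sq_add_cos_sq a
      rw [hb] at this
      nlinarith
    positivity
  · have hs : 0 < Real.cos a ^ 2 := by positivity
    positivity

/-- The couple `P = (L¹_{w₀}, L¹_{w₁})` on `(0, ∞)` with Lebesgue measure, for the weights
`hilbertWeight r a`. -/
def weightCouple (r a : ℝ) (hr : 0 < r) :
    BanachCouple (ℝ →ₘ[(volume : Measure ℝ).restrict (Ioi 0)] ℝ) :=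
  weightedL1Couple ((volume : Measure ℝ).restrict (Ioi 0)) (hilbertWeight r a)
    (measurable_hilbertWeight r a) (fun j => by
      filter_upwards [ae_restrict_mem measurableSet_Ioi] with t ht
      exact hilbertWeight_pos r a hr j t ht)

/-- The number `c_a`: the infimum of the norms of the bounded operators `T : P → G` that take the
constant function `1` to `(cos a, sin a)`. -/
def cConst (r a : ℝ) (hr : 0 < r) : ℝ≥0∞ :=
  ⨅ T ∈ BanachCouple.operatorsTaking (weightCouple r a hr) (hilbertCouple r hr)
    1 (Real.cos a, Real.sin a),
    BanachCouple.opNorm (weightCouple r a hr) (hilbertCouple r hr) T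

end KDiv

end

/-! The bounds on `γ` come from explicit decompositions. If `u = x + y`, put `u_n = β_n x + γ_n y`
with nonnegative weights summing to `1`; then `K(t, u_n)` is at most `β_n min(‖x‖₀, t‖x‖₁) + γ_n
min(‖y‖₀, t‖y‖₁)`, to be compared with `C φ_n(t)` (`exists_divide`). Concavity bounds each `φ_n`
below by a piecewise linear function fixed by its values at one or two nodes, and linear functionals
bound `K(t, u)` below at these nodes (`le_K_of_functional`), which controls the sums of those
values.

With one piece, `x = u`, and one node `‖u‖₀ / ‖u‖₁`, the constant is `‖u‖₀‖u‖₁ / (u₁² + √r u₂²)`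
(`divide_single`). It is at most `(1 + √r) / (2 r^{1/4})`, which lies below `(1 + √r) / 2`. If
moreover `u₁²` is outside `[u₂², r u₂²]`, it is at most `√2 √(1 + r) / (1 + √r) < √2`. Inside that
range two pieces and the nodes `1/√r` and `1` give `√2 √(r / (1 + r)) < √2` (`divide_pair`).

For `c_a`, integrate against the density `(b/(1+s)², rc/(1+rs)²)`, whose integral is `(b, c)`. A
Kantorovich inequality bounds its `G_j` norm pointwise by `(1 + r)/(2√r) · w_j`, and this constant
is below `(1 + √r)/2` because `√r > 1`. -/

namespace KDiv

/-! ### Positive concave functions on the half-line -/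

section Concave

variable {φ : ℝ → ℝ}

lemma le_of_forall_mul_le {x y l : ℝ} (hl : 0 < l) (h : ∀ k, 0 < k → k < l → k * x ≤ y) :
    l * x ≤ y := by
  have h1 : Tendsto (fun k : ℝ => k * x) (𝓝[<] l) (𝓝 (l * x)) :=
    ((continuous_id.mul continuous_const).tendsto l).mono_left nhdsWithin_le_nhds
  refine le_of_tendsto h1 ?_
  filter_upwards [Ioo_mem_nhdsLT hl] with k hk using h k hk.1 hk.2

/-- A positive concave function on `(0, ∞)` is nondecreasing. -/
lemma monotone_of_concave_pos (hc : ConcaveOn ℝ (Ioi 0) φ) (hp : ∀ t > 0, 0 < φ t) {s t : ℝ}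
    (hs : 0 < s) (hst : s ≤ t) : φ s ≤ φ t := by
  rcases hst.eq_or_lt with rfl | hst
  · exact le_rfl
  -- Write `t` as a convex combination of `s`, with weight `k`, and a point beyond `t`. Positivity
  -- of `φ` there gives `k φ(s) ≤ φ(t)`; then `k → 1`.
  have := le_of_forall_mul_le (x := φ s) (y := φ t) one_pos fun k hk hk1 => by
    have h1 : 0 < 1 - k := by linarith
    have hx : 0 < s + (t - s) / (1 - k) := by
      have := div_pos (sub_pos.2 hst) h1
      linarith
    have h2 := hc.2 (mem_Ioi.2 hs) (mem_Ioi.2 hx) hk.le h1.le (by ring)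
    simp only [smul_eq_mul] at h2
    have h3 : k * s + (1 - k) * (s + (t - s) / (1 - k)) = t := by
      field_simp
      ring
    rw [h3] at h2
    have := mul_pos h1 (hp _ hx)
    linarith
  simpa using this

/-- If `φ` is positive and concave on `(0, ∞)`, then `φ(t) / t` is nonincreasing. -/
lemma mul_le_of_concave_pos (hc : ConcaveOn ℝ (Ioi 0) φ) (hp : ∀ t > 0, 0 < φ t) {s t : ℝ}
    (hs : 0 < s) (hst : s ≤ t) : s / t * φ t ≤ φ s := by
  rcases hst.eq_or_lt with rfl | hst
  · rw [div_self hs.ne', one_mul]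
  have ht : 0 < t := hs.trans hst
  -- Now `s` is a convex combination of `t`, with weight `k`, and a smaller point; `k < s / t` is
  -- what keeps that point positive.
  refine le_of_forall_mul_le (div_pos hs ht) fun k hk hk1 => ?_
  have hk2 : k * t < s := (lt_div_iff₀ ht).1 hk1
  have h1 : 0 < 1 - k := by
    have : s / t < 1 := (div_lt_one ht).2 hst
    linarith
  have hx : 0 < (s - k * t) / (1 - k) := div_pos (by linarith) h1
  have h2 := hc.2 (mem_Ioi.2 ht) (mem_Ioi.2 hx) hk.le h1.le (by ring)
  simp only [smul_eq_mul] at h2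
  have h3 : k * t + (1 - k) * ((s - k * t) / (1 - k)) = s := by
    field_simp
    ring
  rw [h3] at h2
  have := mul_pos h1 (hp _ hx)
  linarith

lemma mul_min_le_of_concave_pos (hc : ConcaveOn ℝ (Ioi 0) φ) (hp : ∀ t > 0, 0 < φ t) {s t : ℝ}
    (hs : 0 < s) (ht : 0 < t) : φ s * min 1 (t / s) ≤ φ t := by
  rcases le_total s t with h | h
  · refine le_trans ?_ (monotone_of_concave_pos hc hp hs h)
    exact mul_le_of_le_one_right (hp s hs).le (min_le_left _ _)
  · refine le_trans ?_ (mul_le_of_concave_pos hc hp ht h)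
    rw [mul_comm]
    exact mul_le_mul_of_nonneg_right (min_le_right _ _) (hp s hs).le

/-- The piecewise linear interpolant of a positive concave function at `1 / m` and `1`, continued
linearly to `0` and constantly to `∞`, is a minorant. -/
lemma two_point_minorant (hc : ConcaveOn ℝ (Ioi 0) φ) (hp : ∀ t > 0, 0 < φ t) {m t : ℝ}
    (hm : 1 < m) (ht : 0 < t) :
    m * (φ 1 - φ (1 / m)) / (m - 1) * min 1 t
      + (m * φ (1 / m) - φ 1) / (m - 1) * min 1 (m * t) ≤ φ t := by
  have hm0 : 0 < m := by linarith
  have hm1 : 0 < m - 1 := by linarith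
  have hi : 0 < 1 / m := by positivity
  rcases le_total 1 t with h | h
  · rw [min_eq_left h, min_eq_left (by nlinarith)]
    refine le_trans (le_of_eq ?_) (monotone_of_concave_pos hc hp one_pos h)
    field_simp
    ring
  rcases le_total t (1 / m) with h' | h'
  · have h3 : m * t ≤ 1 := by rwa [le_div_iff₀ hm0, mul_comm] at h'
    rw [min_eq_right h, min_eq_right h3]
    refine le_trans (le_of_eq ?_) (mul_le_of_concave_pos hc hp ht h')
    field_simp
    ring
  · have h3 : 1 ≤ m * t := by rwa [div_le_iff₀ hm0, mul_comm] at h'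
    rw [min_eq_right h, min_eq_left h3]
    have a0 : 0 ≤ m * (1 - t) / (m - 1) := div_nonneg (mul_nonneg hm0.le (by linarith)) hm1.le
    have b0 : 0 ≤ (m * t - 1) / (m - 1) := div_nonneg (by linarith) hm1.le
    have h2 := hc.2 (mem_Ioi.2 hi) (mem_Ioi.2 one_pos) a0 b0 (by field_simp; ring)
    simp only [smul_eq_mul] at h2
    have h4 : m * (1 - t) / (m - 1) * (1 / m) + (m * t - 1) / (m - 1) * 1 = t := by
      field_simp
      ring
    rw [h4] at h2
    refine le_trans (le_of_eq ?_) h2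
    field_simp
    ring

end Concave

/-! ### Dividing a fixed decomposition in a general couple -/

namespace BanachCouple

variable {V : Type*} [AddCommGroup V] [Module ℝ V]

/-- Each summand is placed entirely in whichever of the two spaces makes it cheaper. -/
lemma K_add_le_min (A : BanachCouple V) (t : ℝ) (x y : V) :
    A.K t (x + y) ≤ min (A.nrm 0 x) (ENNReal.ofReal t * A.nrm 1 x)
      + min (A.nrm 0 y) (ENNReal.ofReal t * A.nrm 1 y) := by
  have key : ∀ x₀ x₁, x₀ + x₁ = x + y →
      A.K t (x + y) ≤ A.nrm 0 x₀ + ENNReal.ofReal t * A.nrm 1 x₁ :=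
    fun x₀ x₁ h => iInf_le_of_le x₀ (iInf_le_of_le x₁ (iInf_le_of_le h le_rfl))
  rcases min_choice (A.nrm 0 x) (ENNReal.ofReal t * A.nrm 1 x) with h | h <;>
    rcases min_choice (A.nrm 0 y) (ENNReal.ofReal t * A.nrm 1 y) with k | k <;> rw [h, k]
  · refine (key (x + y) 0 (add_zero _)).trans ?_
    simpa [nrm_zero] using A.nrm_add_le 0 x y
  · exact key x y rfl
  · rw [add_comm (_ * _)]
    exact key y x (add_comm _ _)
  · refine (key 0 (x + y) (zero_add _)).trans ?_
    rw [nrm_zero, zero_add, ← mul_add]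
    gcongr
    exact A.nrm_add_le 1 x y

/-- `‖x‖_{A_0} ≤ M` and `‖x‖_{A_1} ≤ M'` give `min(‖x‖_{A_0}, t‖x‖_{A_1}) ≤ min(M, tM')`, with a
nonnegative factor. -/
lemma min_nrm_smul_le (A : BanachCouple V) {t k M M' : ℝ} (ht : 0 ≤ t) (hk : 0 ≤ k) {x : V}
    (h₀ : A.nrm 0 x ≤ ENNReal.ofReal M) (h₁ : A.nrm 1 x ≤ ENNReal.ofReal M') :
    min (A.nrm 0 (k • x)) (ENNReal.ofReal t * A.nrm 1 (k • x))
      ≤ ENNReal.ofReal (k * min M (t * M')) := by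
  rw [mul_min_of_nonneg _ _ hk, ENNReal.ofReal_min, A.nrm_smul, A.nrm_smul,
    Real.enorm_eq_ofReal hk, ENNReal.ofReal_mul hk,
    show k * (t * M') = t * (k * M') by ring, ENNReal.ofReal_mul ht, ENNReal.ofReal_mul hk]
  gcongr

/-- A decomposition `u = x + y` is divided along two sequences of weights. -/
lemma exists_divide (A : BanachCouple V) {x y : V} {M M' N N' : ℝ}
    (hx₀ : A.nrm 0 x ≤ ENNReal.ofReal M) (hx₁ : A.nrm 1 x ≤ ENNReal.ofReal M')
    (hy₀ : A.nrm 0 y ≤ ENNReal.ofReal N) (hy₁ : A.nrm 1 y ≤ ENNReal.ofReal N')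
    (hM : 0 ≤ M) (hM' : 0 ≤ M') (hN : 0 ≤ N) (hN' : 0 ≤ N')
    {β γ : ℕ → ℝ} (hβ : ∀ n, 0 ≤ β n) (hγ : ∀ n, 0 ≤ γ n) (hβ1 : HasSum β 1) (hγ1 : HasSum γ 1)
    {C : ℝ≥0} {φ : ℕ → ℝ → ℝ}
    (hφ : ∀ n, ∀ t > 0, β n * min M (t * M') + γ n * min N (t * N') ≤ C * φ n t) :
    ∃ u : ℕ → V, (∀ n, u n ∈ A.sum) ∧
      Tendsto (fun n => A.K 1 (x + y - ∑ i ∈ Finset.range n, u i)) atTop (𝓝 0) ∧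
      ∀ n, ∀ t > 0, A.K t (u n) ≤ C * ENNReal.ofReal (φ n t) := by
  have hx : x ∈ A.sum := ⟨x, 0, add_zero _, ne_top_of_le_ne_top ENNReal.ofReal_ne_top hx₀,
    by simp [nrm_zero]⟩
  have hy : y ∈ A.sum := ⟨y, 0, add_zero _, ne_top_of_le_ne_top ENNReal.ofReal_ne_top hy₀,
    by simp [nrm_zero]⟩
  have tail : ∀ {δ : ℕ → ℝ}, (∀ n, 0 ≤ δ n) → HasSum δ 1 →
      (∀ n, 0 ≤ 1 - ∑ i ∈ Finset.range n, δ i) ∧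
        Tendsto (fun n => 1 - ∑ i ∈ Finset.range n, δ i) atTop (𝓝 0) := fun hδ h =>
    ⟨fun n => sub_nonneg.2 (sum_le_hasSum _ (fun i _ => hδ i) h), by
      simpa using (tendsto_const_nhds (x := (1 : ℝ))).sub h.tendsto_sum_nat⟩
  obtain ⟨tβ, lβ⟩ := tail hβ hβ1
  obtain ⟨tγ, lγ⟩ := tail hγ hγ1
  have est : ∀ {t b c : ℝ}, 0 ≤ t → 0 ≤ b → 0 ≤ c → A.K t (b • x + c • y)
      ≤ ENNReal.ofReal (b * min M (t * M') + c * min N (t * N')) := by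
    intro t b c ht hb hc
    rw [ENNReal.ofReal_add (by positivity) (by positivity)]
    exact (A.K_add_le_min t _ _).trans (add_le_add (A.min_nrm_smul_le ht hb hx₀ hx₁)
      (A.min_nrm_smul_le ht hc hy₀ hy₁))
  refine ⟨fun n => β n • x + γ n • y,
    fun n => A.sum.add_mem (A.sum.smul_mem _ hx) (A.sum.smul_mem _ hy), ?_, ?_⟩
  -- The remainder is again a combination of `x` and `y`, with the tails of the two weight series as
  -- coefficients, so the same estimate applies at `t = 1`.
  · have hl : Tendsto (fun n => ENNReal.ofReal
        ((1 - ∑ i ∈ Finset.range n, β i) * min M (1 * M')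
          + (1 - ∑ i ∈ Finset.range n, γ i) * min N (1 * N'))) atTop (𝓝 0) := by
      rw [← ENNReal.ofReal_zero]
      refine ENNReal.tendsto_ofReal ?_
      simpa using (lβ.mul_const (min M (1 * M'))).add (lγ.mul_const (min N (1 * N')))
    refine tendsto_of_tendsto_of_tendsto_of_le_of_le tendsto_const_nhds hl (fun _ => zero_le)
      fun n => ?_
    refine le_trans (le_of_eq ?_) (est zero_le_one (tβ n) (tγ n))
    congr 1
    rw [Finset.sum_add_distrib, ← Finset.sum_smul, ← Finset.sum_smul, sub_smul, sub_smul,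
      one_smul, one_smul]
    abel
  · intro n t ht
    refine (est ht.le (hβ n) (hγ n)).trans ?_
    rw [← ENNReal.ofReal_coe_nnreal, ← ENNReal.ofReal_mul C.coe_nonneg]
    exact ENNReal.ofReal_le_ofReal (hφ n t ht)

lemma exists_divide_zero (A : BanachCouple V) (C : ℝ≥0) (φ : ℕ → ℝ → ℝ) :
    ∃ u : ℕ → V, (∀ n, u n ∈ A.sum) ∧
      Tendsto (fun n => A.K 1 (0 - ∑ i ∈ Finset.range n, u i)) atTop (𝓝 0) ∧
      ∀ n, ∀ t > 0, A.K t (u n) ≤ C * ENNReal.ofReal (φ n t) := by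
  have h0 : ∀ t, A.K t 0 = 0 := fun t => le_antisymm (by
    simpa [nrm_zero] using A.K_add_le_min t 0 0) zero_le
  exact ⟨fun _ => 0, fun _ => A.sum.zero_mem, by simp [h0], by simp [h0]⟩

end BanachCouple

/-! ### Moving mass between the two nodes -/

/-- Masses `B` at the point `1` and `D` at the point `1 / m` are obtained from masses `B'`, `D'`
with a larger piecewise linear function by moving mass. -/
lemma exists_mass_transfer {m B D B' D' : ℝ} (hB : 0 < B) (hD : 0 < D)
    (h₁ : B + D ≤ B' + D') (h₂ : B + m * D ≤ B' + m * D') :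
    ∃ p q p' q' : ℝ, 0 ≤ p ∧ 0 ≤ q ∧ 0 ≤ p' ∧ 0 ≤ q' ∧ p * B' + q * D' = B ∧
      p' * B' + q' * D' = D ∧ p + m * p' ≤ 1 ∧ q + q' ≤ 1 := by
  rcases lt_or_ge D' D with h | h
  -- The deficit `D - D'` at `1 / m` is paid from `1`, at the price of `m` units per unit. In the
  -- opposite case mass moves from `1 / m` to `1` at par, and with no deficit both masses are just
  -- scaled down.
  · have hp : 0 < B' := by nlinarith
    refine ⟨B / B', 0, (D - D') / B', 1, by positivity, le_rfl,
      div_nonneg (by linarith) hp.le, zero_le_one, ?_, ?_, ?_, by simp⟩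
    · field_simp; simp
    · field_simp; ring
    · rw [mul_div_assoc', ← add_div, div_le_one hp]
      linarith
  · have hp : 0 < D' := by linarith
    rcases lt_or_ge B' B with k | k
    · refine ⟨1, (B - B') / D', 0, D / D', zero_le_one, div_nonneg (by linarith) hp.le, le_rfl,
        by positivity, ?_, ?_, by simp, ?_⟩
      · field_simp; ring
      · field_simp; simp
      · rw [← add_div, div_le_one hp]
        linarith
    · have hp' : 0 < B' := by linarith
      refine ⟨B / B', 0, 0, D / D', by positivity, le_rfl, le_rfl, by positivity, ?_, ?_, ?_, ?_⟩
      · field_simp; simp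
      · field_simp; simp
      · rw [mul_zero, add_zero]; exact (div_le_one hp').2 k
      · rw [zero_add]; exact (div_le_one hp).2 h

/-- The prices of the transfer are right because `min 1 t ≤ min 1 (m t) ≤ m min 1 t`. The transfer
coefficients come from the total masses, but this applies to the masses of each `φ_n` separately. -/
lemma transfer_le {m t B D p q p' q' : ℝ} (hm : 1 ≤ m) (ht : 0 < t) (hB : 0 ≤ B) (hD : 0 ≤ D)
    (hp' : 0 ≤ p') (hq : 0 ≤ q) (h : p + m * p' ≤ 1) (h' : q + q' ≤ 1) :
    (p * B + q * D) * min 1 t + (p' * B + q' * D) * min 1 (m * t)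
      ≤ B * min 1 t + D * min 1 (m * t) := by
  have m0 : 0 < m := by linarith
  set X := min 1 t with hX
  set Y := min 1 (m * t) with hY
  have X0 : 0 ≤ X := by positivity
  have Y0 : 0 ≤ Y := by positivity
  have XY : X ≤ Y := min_le_min le_rfl (le_mul_of_one_le_left ht.le hm)
  have YX : Y ≤ m * X := by
    rw [hX, mul_min_of_nonneg _ _ m0.le, mul_one]
    exact min_le_min hm le_rfl
  have j1 : p * X + p' * Y ≤ X := by
    nlinarith [mul_le_mul_of_nonneg_left YX hp', mul_le_mul_of_nonneg_right h X0]
  have j2 : q * X + q' * Y ≤ Y := by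
    nlinarith [mul_le_mul_of_nonneg_left XY hq, mul_le_mul_of_nonneg_right h' Y0]
  have := mul_le_mul_of_nonneg_left j1 hB
  have := mul_le_mul_of_nonneg_left j2 hD
  linarith

/-! ### Lower bounds for `K` and the two divisions in the Hilbert couple -/

section Hilbert

variable {r : ℝ}

lemma hilbertCouple_nrm_zero (hr : 0 < r) (v : ℝ × ℝ) :
    (hilbertCouple r hr).nrm 0 v = ENNReal.ofReal (√(v.1 ^ 2 + v.2 ^ 2)) := by
  simp [hilbertCouple]

lemma hilbertCouple_nrm_one (hr : 0 < r) (v : ℝ × ℝ) :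
    (hilbertCouple r hr).nrm 1 v = ENNReal.ofReal (√(v.1 ^ 2 + r * v.2 ^ 2)) := by
  simp [hilbertCouple]

/-- A functional of norm at most `1` on `G₀` and at most `t` on `G₁` is bounded by `K(t, ·)`. -/
lemma le_K_of_functional (hr : 0 < r) {t k l : ℝ} (ht : 0 ≤ t) (h₀ : k ^ 2 + l ^ 2 ≤ 1)
    (h₁ : k ^ 2 + l ^ 2 / r ≤ t ^ 2) (v : ℝ × ℝ) :
    ENNReal.ofReal (k * v.1 + l * v.2) ≤ (hilbertCouple r hr).K t v := by
  refine le_iInf fun x => le_iInf fun y => le_iInf fun h => ?_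
  rw [hilbertCouple_nrm_zero, hilbertCouple_nrm_one, ← ENNReal.ofReal_mul ht,
    ← ENNReal.ofReal_add (by positivity) (by positivity)]
  refine ENNReal.ofReal_le_ofReal ?_
  have a₀ : k * x.1 + l * x.2 ≤ √(x.1 ^ 2 + x.2 ^ 2) := by
    refine Real.le_sqrt_of_sq_le ?_
    nlinarith [sq_nonneg (k * x.2 - l * x.1), sq_nonneg x.1, sq_nonneg x.2]
  have a₁ : k * y.1 + l * y.2 ≤ t * √(y.1 ^ 2 + r * y.2 ^ 2) := by
    rw [← Real.sqrt_sq ht, ← Real.sqrt_mul (sq_nonneg t)]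
    refine Real.le_sqrt_of_sq_le ?_
    have e : (k ^ 2 + l ^ 2 / r) * (y.1 ^ 2 + r * y.2 ^ 2)
        = (k * y.1 + l * y.2) ^ 2 + (k * r * y.2 - l * y.1) ^ 2 / r := by
      field_simp
      ring
    have e2 : (k ^ 2 + l ^ 2 / r) * (y.1 ^ 2 + r * y.2 ^ 2)
        ≤ t ^ 2 * (y.1 ^ 2 + r * y.2 ^ 2) := by gcongr
    have e3 : 0 ≤ (k * r * y.2 - l * y.1) ^ 2 / r := by positivity
    linarith
  rw [← h, Prod.fst_add, Prod.snd_add]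
  linarith

lemma le_tsum_of_K_le (hr : 0 < r) {t k l : ℝ} (ht : 0 ≤ t) (h₀ : k ^ 2 + l ^ 2 ≤ 1)
    (h₁ : k ^ 2 + l ^ 2 / r ≤ t ^ 2) (v : ℝ × ℝ) {φ : ℕ → ℝ} (hφ : ∀ n, 0 ≤ φ n)
    (hs : Summable φ) (hK : (hilbertCouple r hr).K t v ≤ ∑' n, ENNReal.ofReal (φ n)) :
    k * v.1 + l * v.2 ≤ ∑' n, φ n := by
  rw [← ENNReal.ofReal_tsum_of_nonneg hφ hs] at hK
  exact (ENNReal.ofReal_le_ofReal_iff (tsum_nonneg hφ)).1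
    ((le_K_of_functional hr ht h₀ h₁ v).trans hK)

/-- Division of `v` into multiples of itself. -/
lemma divide_single (hr : 1 < r) {C : ℝ≥0} {v : ℝ × ℝ} (hv : v ≠ 0)
    (hC : √(v.1 ^ 2 + v.2 ^ 2) * √(v.1 ^ 2 + r * v.2 ^ 2) ≤ C * (v.1 ^ 2 + √r * v.2 ^ 2))
    {φ : ℕ → ℝ → ℝ} (hc : ∀ n, ConcaveOn ℝ (Ioi 0) (φ n)) (hp : ∀ n, ∀ t > 0, 0 < φ n t)
    (hs : Summable (fun n => φ n 1))
    (hK : ∀ t > 0, (hilbertCouple r (zero_lt_one.trans hr)).K t v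
      ≤ ∑' n, ENNReal.ofReal (φ n t)) :
    ∃ u : ℕ → ℝ × ℝ, (∀ n, u n ∈ (hilbertCouple r (zero_lt_one.trans hr)).sum) ∧
      Tendsto (fun n => (hilbertCouple r (zero_lt_one.trans hr)).K 1
        (v - ∑ i ∈ Finset.range n, u i)) atTop (𝓝 0) ∧
      ∀ n, ∀ t > 0, (hilbertCouple r (zero_lt_one.trans hr)).K t (u n)
        ≤ C * ENNReal.ofReal (φ n t) := by
  have hr0 : 0 < r := zero_lt_one.trans hr
  have hpos : 0 < v.1 ^ 2 + v.2 ^ 2 := by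
    by_contra! h
    refine hv (Prod.ext ?_ ?_)
    · exact pow_eq_zero_iff two_ne_zero |>.1 (by nlinarith [sq_nonneg v.1, sq_nonneg v.2])
    · exact pow_eq_zero_iff two_ne_zero |>.1 (by nlinarith [sq_nonneg v.1, sq_nonneg v.2])
  have hpos' : 0 < v.1 ^ 2 + r * v.2 ^ 2 := by nlinarith [sq_nonneg v.2]
  set M := √(v.1 ^ 2 + v.2 ^ 2) with hM
  set M' := √(v.1 ^ 2 + r * v.2 ^ 2) with hM'
  have M0 : 0 < M := Real.sqrt_pos.2 hpos
  have M0' : 0 < M' := Real.sqrt_pos.2 hpos'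
  have sM : M ^ 2 = v.1 ^ 2 + v.2 ^ 2 := Real.sq_sqrt hpos.le
  have sM' : M' ^ 2 = v.1 ^ 2 + r * v.2 ^ 2 := Real.sq_sqrt hpos'.le
  have sr : √r ^ 2 = r := Real.sq_sqrt hr0.le
  have hMM : M ≤ M' := Real.sqrt_le_sqrt (by nlinarith [sq_nonneg v.2])
  -- The kink of `t ↦ min(M, t M')`, hence the natural node.
  set τ := M / M' with hτ
  have τ0 : 0 < τ := div_pos M0 M0'
  have τ1 : τ ≤ 1 := (div_le_one M0').2 hMM
  have hsτ : Summable (fun n => φ n τ) := Summable.of_nonneg_of_le (fun n => (hp n τ τ0).le)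
    (fun n => monotone_of_concave_pos (hc n) (hp n) τ0 τ1) hs
  set S := ∑' n, φ n τ with hS
  have S0 : 0 < S := hsτ.tsum_pos (fun n => (hp n τ τ0).le) 0 (hp 0 τ τ0)
  have hlow : (v.1 ^ 2 + √r * v.2 ^ 2) / M' ≤ S := by
    -- This functional has dual norm exactly `1` on `G₀` and exactly `τ` on `G₁`.
    have := le_tsum_of_K_le hr0 (k := v.1 / M') (l := √r * v.2 / M') τ0.le ?_ ?_ v
      (fun n => (hp n τ τ0).le) hsτ (hK τ τ0)
    · refine le_trans (le_of_eq ?_) this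
      field_simp
    · rw [div_pow, div_pow, ← add_div, div_le_one (by positivity), sM', mul_pow, sr]
    · rw [hτ, div_pow, div_pow, div_pow, mul_pow, sr, sM]
      refine le_of_eq ?_
      field_simp
  have hMS : M ≤ C * S := by
    rw [div_le_iff₀ M0'] at hlow
    have : M * M' ≤ C * S * M' := by
      refine hC.trans ?_
      rw [mul_assoc]
      exact mul_le_mul_of_nonneg_left hlow C.coe_nonneg
    exact le_of_mul_le_mul_right this M0'
  have hsum : HasSum (fun n => φ n τ / S) 1 := by
    have := hsτ.hasSum.div_const S
    rwa [div_self S0.ne'] at this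
  have := (hilbertCouple r hr0).exists_divide (x := v) (y := 0) (M := M) (M' := M') (N := 0)
    (N' := 0) (hilbertCouple_nrm_zero hr0 v).le (hilbertCouple_nrm_one hr0 v).le
    (by simp [BanachCouple.nrm_zero]) (by simp [BanachCouple.nrm_zero]) M0.le M0'.le le_rfl le_rfl
    (fun n => div_nonneg (hp n τ τ0).le S0.le) (fun n => div_nonneg (hp n τ τ0).le S0.le) hsum hsum
    (C := C) (φ := φ) ?_
  · simpa only [add_zero] using this
  · intro n t ht
    have e1 : min M (t * M') = M * min 1 (t / τ) := by
      rw [mul_min_of_nonneg _ _ M0.le, mul_one, hτ]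
      congr 1
      field_simp
    have e2 := mul_min_le_of_concave_pos (hc n) (hp n) τ0 ht
    have e3 : 0 ≤ min 1 (t / τ) := by positivity
    rw [mul_zero, min_self, mul_zero, add_zero, e1]
    calc φ n τ / S * (M * min 1 (t / τ)) = M / S * (φ n τ * min 1 (t / τ)) := by ring
      _ ≤ C * φ n t := by
        refine mul_le_mul ((div_le_iff₀ S0).2 hMS) e2 ?_ C.coe_nonneg
        exact mul_nonneg (hp n τ τ0).le e3

/-- Division of `v` into combinations of `(rx, y) / (1 + r)` and `(x, ry) / (1 + r)`. -/
lemma divide_pair (hr : 1 < r) {C : ℝ≥0} {v : ℝ × ℝ} (hv : v ≠ 0)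
    (h₁ : v.2 ^ 2 ≤ v.1 ^ 2) (h₂ : v.1 ^ 2 ≤ r * v.2 ^ 2) (hC : √2 * √(r / (1 + r)) ≤ C)
    {φ : ℕ → ℝ → ℝ} (hc : ∀ n, ConcaveOn ℝ (Ioi 0) (φ n)) (hp : ∀ n, ∀ t > 0, 0 < φ n t)
    (hs : Summable (fun n => φ n 1))
    (hK : ∀ t > 0, (hilbertCouple r (zero_lt_one.trans hr)).K t v
      ≤ ∑' n, ENNReal.ofReal (φ n t)) :
    ∃ u : ℕ → ℝ × ℝ, (∀ n, u n ∈ (hilbertCouple r (zero_lt_one.trans hr)).sum) ∧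
      Tendsto (fun n => (hilbertCouple r (zero_lt_one.trans hr)).K 1
        (v - ∑ i ∈ Finset.range n, u i)) atTop (𝓝 0) ∧
      ∀ n, ∀ t > 0, (hilbertCouple r (zero_lt_one.trans hr)).K t (u n)
        ≤ C * ENNReal.ofReal (φ n t) := by
  have hr0 : 0 < r := zero_lt_one.trans hr
  have hx : v.1 ≠ 0 := fun h => hv (Prod.ext h (pow_eq_zero_iff two_ne_zero |>.1
    (by rw [h] at h₁; nlinarith [sq_nonneg v.2])))
  have hy : v.2 ≠ 0 := fun h => hx (pow_eq_zero_iff two_ne_zero |>.1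
    (by rw [h] at h₂; nlinarith [sq_nonneg v.1]))
  set m := √r with hm
  have sr : m ^ 2 = r := Real.sq_sqrt hr0.le
  have m1 : 1 < m := by rw [hm, Real.lt_sqrt zero_le_one]; simpa using hr
  have m0 : 0 < m := by linarith
  have mi : 0 < 1 / m := by positivity
  have mi1 : 1 / m ≤ 1 := (div_le_one m0).2 m1.le
  have hsm : Summable (fun n => φ n (1 / m)) := Summable.of_nonneg_of_le
    (fun n => (hp n _ mi).le) (fun n => monotone_of_concave_pos (hc n) (hp n) mi mi1) hs
  -- `B n` and `D n` are the coefficients for which `B n min(1, t) + D n min(1, m t)` agrees with `φ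
  -- n` at `t = 1` and `t = 1 / m`.
  set B : ℕ → ℝ := fun n => m * (φ n 1 - φ n (1 / m)) / (m - 1) with hB
  set D : ℕ → ℝ := fun n => (m * φ n (1 / m) - φ n 1) / (m - 1) with hD
  have mm : 0 < m - 1 := by linarith
  have B0 : ∀ n, 0 ≤ B n := fun n => div_nonneg (mul_nonneg m0.le
    (sub_nonneg.2 (monotone_of_concave_pos (hc n) (hp n) mi mi1))) mm.le
  have D0 : ∀ n, 0 ≤ D n := fun n => by
    have := mul_le_of_concave_pos (hc n) (hp n) mi mi1
    rw [div_one, one_div_mul_eq_div, div_le_iff₀ m0] at this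
    exact div_nonneg (by linarith) mm.le
  have sB : Summable B := ((hs.sub hsm).mul_left m).div_const _
  have sD : Summable D := ((hsm.mul_left m).sub hs).div_const _
  have e1 : ∑' n, φ n 1 = ∑' n, B n + ∑' n, D n := by
    rw [← sB.tsum_add sD]
    congr 1 with n
    simp only [hB, hD]
    field_simp
    ring
  have e2 : m * ∑' n, φ n (1 / m) = ∑' n, B n + m * ∑' n, D n := by
    rw [← tsum_mul_left, ← tsum_mul_left, ← sB.tsum_add (sD.mul_left m)]
    congr 1 with n
    simp only [hB, hD]
    field_simp
    ring
  have q2 : √2 ^ 2 = (2 : ℝ) := Real.sq_sqrt zero_le_two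
  have q0 : 0 < √(2 : ℝ) := by positivity
  -- The signs turn the functionals with coefficients `±1/√2, ±1/√2` at `t = 1` and `±1/(√2 m),
  -- ±1/√2` at `t = 1 / m` into combinations of `|v.1|` and `|v.2|`.
  set k := SignType.sign v.1 with hk
  set l := SignType.sign v.2 with hl
  have k2 : (k : ℝ) ^ 2 = 1 := by
    rcases lt_or_gt_of_ne hx with h | h <;> simp [hk, h]
  have l2 : (l : ℝ) ^ 2 = 1 := by
    rcases lt_or_gt_of_ne hy with h | h <;> simp [hl, h]
  have kv : (k : ℝ) * v.1 = |v.1| := sign_mul_self _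
  have lv : (l : ℝ) * v.2 = |v.2| := sign_mul_self _
  have f1 : |v.1| + |v.2| ≤ √2 * ∑' n, φ n 1 := by
    have := le_tsum_of_K_le hr0 (k := k / √2) (l := l / √2) zero_le_one ?_ ?_ v
      (fun n => (hp n 1 one_pos).le) hs (hK 1 one_pos)
    · rw [div_mul_eq_mul_div, div_mul_eq_mul_div, kv, lv, ← add_div, div_le_iff₀ q0] at this
      linarith
    · rw [div_pow, div_pow, q2, k2, l2]; norm_num
    · rw [div_pow, div_pow, q2, k2, l2]
      have : (1 : ℝ) / 2 / r ≤ 1 / 2 := div_le_self (by norm_num) hr.le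
      linarith
  have f2 : |v.1| + m * |v.2| ≤ √2 * (m * ∑' n, φ n (1 / m)) := by
    have := le_tsum_of_K_le hr0 (k := k / (√2 * m)) (l := l / √2) mi.le ?_ ?_ v
      (fun n => (hp n _ mi).le) hsm (hK _ mi)
    · have e : k / (√2 * m) * v.1 + l / √2 * v.2 = (|v.1| + m * |v.2|) / (√2 * m) := by
        rw [← kv, ← lv]
        field_simp
      rw [e, div_le_iff₀ (by positivity)] at this
      linarith
    · rw [div_pow, div_pow, mul_pow, q2, k2, l2, sr]
      have : (1 : ℝ) / (2 * r) ≤ 1 / 2 := one_div_le_one_div_of_le two_pos (by linarith)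
      linarith
    · rw [div_pow, div_pow, div_pow, mul_pow, q2, k2, l2, sr]
      refine le_of_eq ?_
      field_simp
      norm_num
  have b0 : 0 < |v.1| := abs_pos.2 hx
  have d0 : 0 < |v.2| := abs_pos.2 hy
  -- `f1` and `f2` say that `|v.1| min(1, t) + |v.2| min(1, m t)` is dominated at both nodes by `√2`
  -- times the sum of the interpolants. The transfer turns this domination into equality of masses,
  -- so that the weights below sum to `1`.
  obtain ⟨p, q, p', q', hp0, hq0, hp0', hq0', E, E', F, F'⟩ := exists_mass_transfer (m := m) b0 d0
    (B' := √2 * ∑' n, B n) (D' := √2 * ∑' n, D n) (by rw [e1] at f1; linarith) (by rw [e2] at f2; linarith)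
  set θ := √(r / (1 + r)) with hθ
  have θ0 : 0 ≤ θ := Real.sqrt_nonneg _
  have θ2 : θ ^ 2 = r / (1 + r) := Real.sq_sqrt (by positivity)
  -- The first piece has both norms at most `θ |v.1|`, so it matches mass at `1`; this uses `v.2² ≤
  -- v.1²`. By `g2`, the second has norms at most `θ |v.2|` and `m θ |v.2|`, so it matches mass at
  -- `1 / m`; this uses `v.1² ≤ r v.2²`.
  have g1 : √((r / (1 + r) * v.1) ^ 2 + r * (1 / (1 + r) * v.2) ^ 2) ≤ θ * |v.1| := by
    refine Real.sqrt_le_iff.2 ⟨by positivity, ?_⟩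
    rw [mul_pow θ, θ2, sq_abs]
    have e : r / (1 + r) * v.1 ^ 2 - ((r / (1 + r) * v.1) ^ 2 + r * (1 / (1 + r) * v.2) ^ 2)
        = r / (1 + r) ^ 2 * (v.1 ^ 2 - v.2 ^ 2) := by
      field_simp
      ring
    have : 0 ≤ r / (1 + r) ^ 2 * (v.1 ^ 2 - v.2 ^ 2) :=
      mul_nonneg (by positivity) (by linarith)
    linarith
  have g2 : √((1 / (1 + r) * v.1) ^ 2 + (r / (1 + r) * v.2) ^ 2) ≤ θ * |v.2| := by
    refine Real.sqrt_le_iff.2 ⟨by positivity, ?_⟩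
    rw [mul_pow θ, θ2, sq_abs]
    have e : r / (1 + r) * v.2 ^ 2 - ((1 / (1 + r) * v.1) ^ 2 + (r / (1 + r) * v.2) ^ 2)
        = 1 / (1 + r) ^ 2 * (r * v.2 ^ 2 - v.1 ^ 2) := by
      field_simp
      ring
    have : 0 ≤ 1 / (1 + r) ^ 2 * (r * v.2 ^ 2 - v.1 ^ 2) :=
      mul_nonneg (by positivity) (by linarith)
    linarith
  have hsplit : ((r / (1 + r) * v.1, 1 / (1 + r) * v.2) : ℝ × ℝ)
      + (1 / (1 + r) * v.1, r / (1 + r) * v.2) = v := by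
    ext
    · simp only [Prod.fst_add]; field_simp; ring
    · simp only [Prod.snd_add]; field_simp
  have := (hilbertCouple r hr0).exists_divide (x := (r / (1 + r) * v.1, 1 / (1 + r) * v.2))
    (y := (1 / (1 + r) * v.1, r / (1 + r) * v.2)) (M := θ * |v.1|) (M' := θ * |v.1|)
    (N := θ * |v.2|) (N' := m * (θ * |v.2|)) ?_ ?_ ?_ ?_ (by positivity) (by positivity)
    (by positivity) (by positivity)
    (β := fun n => √2 * (p * B n + q * D n) / |v.1|)
    (γ := fun n => √2 * (p' * B n + q' * D n) / |v.2|) ?_ ?_ ?_ ?_ (C := C) (φ := φ) ?_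
  · rwa [hsplit] at this
  · rw [hilbertCouple_nrm_zero]
    refine ENNReal.ofReal_le_ofReal (le_trans (Real.sqrt_le_sqrt ?_) g1)
    have := mul_nonneg (sub_nonneg.2 hr.le) (sq_nonneg (1 / (1 + r) * v.2))
    simp only
    linarith
  · rw [hilbertCouple_nrm_one]
    exact ENNReal.ofReal_le_ofReal g1
  · rw [hilbertCouple_nrm_zero]
    exact ENNReal.ofReal_le_ofReal g2
  · rw [hilbertCouple_nrm_one]
    refine ENNReal.ofReal_le_ofReal (le_trans ?_ (mul_le_mul_of_nonneg_left g2 m0.le))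
    rw [hm, ← Real.sqrt_mul hr0.le]
    refine Real.sqrt_le_sqrt ?_
    have := mul_nonneg (sub_nonneg.2 hr.le) (sq_nonneg (1 / (1 + r) * v.1))
    simp only
    linarith
  · intro n
    have := B0 n
    have := D0 n
    positivity
  · intro n
    have := B0 n
    have := D0 n
    positivity
  · have := (((sB.hasSum.mul_left p).add (sD.hasSum.mul_left q)).mul_left √2).div_const |v.1|
    rwa [show √2 * (p * ∑' n, B n + q * ∑' n, D n) = |v.1| by rw [← E]; ring,
      div_self b0.ne'] at this
  · have := (((sB.hasSum.mul_left p').add (sD.hasSum.mul_left q')).mul_left √2).div_const |v.2|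
    rwa [show √2 * (p' * ∑' n, B n + q' * ∑' n, D n) = |v.2| by rw [← E']; ring,
      div_self d0.ne'] at this
  · intro n t ht
    have hn := two_point_minorant (hc n) (hp n) m1 ht
    change B n * min 1 t + D n * min 1 (m * t) ≤ φ n t at hn
    have i1 : min (θ * |v.1|) (t * (θ * |v.1|)) = θ * |v.1| * min 1 t := by
      rw [mul_min_of_nonneg _ _ (by positivity), mul_one, mul_comm t]
    have i2 : min (θ * |v.2|) (t * (m * (θ * |v.2|))) = θ * |v.2| * min 1 (m * t) := by
      rw [mul_min_of_nonneg _ _ (by positivity), mul_one]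
      congr 1
      ring
    rw [i1, i2]
    have key := (transfer_le m1.le ht (B0 n) (D0 n) hp0' hq0 F F').trans hn
    set X := min 1 t
    set Y := min 1 (m * t)
    have e : √2 * (p * B n + q * D n) / |v.1| * (θ * |v.1| * X)
        + √2 * (p' * B n + q' * D n) / |v.2| * (θ * |v.2| * Y)
        = √2 * θ * ((p * B n + q * D n) * X + (p' * B n + q' * D n) * Y) := by
      field_simp
    rw [e]
    refine (mul_le_mul_of_nonneg_left key (by positivity)).trans ?_
    exact mul_le_mul_of_nonneg_right hC (hp n t ht).le

/-! ### The two bounds for `γ` -/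

lemma gamma_le {V : Type*} [AddCommGroup V] [Module ℝ V] {A : BanachCouple V} {C : ℝ}
    (h : A.IsKDivisibilityConst C.toNNReal) : A.gamma ≤ ENNReal.ofReal C := by
  exact iInf₂_le _ h

lemma gamma_lt_half_one_add_sqrt (hr : 1 < r) :
    (hilbertCouple r (zero_lt_one.trans hr)).gamma < ENNReal.ofReal ((1 + √r) / 2) := by
  have hr0 : 0 < r := zero_lt_one.trans hr
  set m := √r with hm
  have sr : m ^ 2 = r := Real.sq_sqrt hr0.le
  have m1 : 1 < m := by rw [hm, Real.lt_sqrt zero_le_one]; simpa using hr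
  have m0 : 0 < m := by linarith
  have q1 : 1 < √m := by rw [Real.lt_sqrt zero_le_one]; simpa using m1
  have qm : √m ^ 2 = m := Real.sq_sqrt m0.le
  refine lt_of_le_of_lt (gamma_le (C := (1 + m) / (2 * √m)) ?_) ?_
  · intro v _ φ hc hp hs hK
    rcases eq_or_ne v 0 with rfl | hv
    · exact BanachCouple.exists_divide_zero _ _ _
    refine divide_single hr hv ?_ hc hp hs hK
    rw [Real.coe_toNNReal _ (by positivity)]
    rw [← Real.sqrt_mul (by positivity)]
    refine Real.sqrt_le_iff.2 ⟨?_, ?_⟩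
    · positivity
    · rw [mul_pow, div_pow, mul_pow, qm, ← sr]
      rw [div_mul_eq_mul_div, le_div_iff₀ (by positivity)]
      have : √(m ^ 2) = m := Real.sqrt_sq m0.le
      rw [this]
      -- The difference of the two sides is exactly the hinted product; equality holds at `v.1² = m
      -- v.2²`.
      nlinarith [mul_nonneg (sq_nonneg (m - 1)) (sq_nonneg (v.1 ^ 2 - m * v.2 ^ 2))]
  · refine (ENNReal.ofReal_lt_ofReal_iff (by positivity)).2 ?_
    refine div_lt_div_of_pos_left (by positivity) two_pos (by linarith)

lemma gamma_lt_sqrt_two (hr : 1 < r) :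
    (hilbertCouple r (zero_lt_one.trans hr)).gamma < ENNReal.ofReal (√2) := by
  have hr0 : 0 < r := zero_lt_one.trans hr
  set m := √r with hm
  have sr : m ^ 2 = r := Real.sq_sqrt hr0.le
  have m1 : 1 < m := by rw [hm, Real.lt_sqrt zero_le_one]; simpa using hr
  have m0 : 0 < m := by linarith
  have q0 : 0 < √(2 : ℝ) := by positivity
  have q2 : √2 ^ 2 = (2 : ℝ) := Real.sq_sqrt zero_le_two
  refine lt_of_le_of_lt (gamma_le
    (C := max (√2 * √(r / (1 + r))) (√2 * (√(1 + r) / (1 + m)))) ?_) ?_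
  · intro v _ φ hc hp hs hK
    rcases eq_or_ne v 0 with rfl | hv
    · exact BanachCouple.exists_divide_zero _ _ _
    by_cases h : v.2 ^ 2 ≤ v.1 ^ 2 ∧ v.1 ^ 2 ≤ r * v.2 ^ 2
    · exact divide_pair hr hv h.1 h.2 ((le_max_left _ _).trans (Real.le_coe_toNNReal _)) hc hp hs hK
    refine divide_single hr hv ?_ hc hp hs hK
    rw [Real.coe_toNNReal _ (by positivity)]
    -- Times `(m - 1)²`, this product is the difference of the two sides of the cleared inequality.
    -- The one-piece constant thus reaches `√2 √(1 + r) / (1 + m)` on the boundary of the two-piece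
    -- range.
    have hprod : 0 ≤ (v.1 ^ 2 - v.2 ^ 2) * (v.1 ^ 2 - r * v.2 ^ 2) := by
      rcases le_total (v.2 ^ 2) (v.1 ^ 2) with h1 | h1
      · have h2 : r * v.2 ^ 2 < v.1 ^ 2 := by
          by_contra! h2
          exact h ⟨h1, h2⟩
        exact mul_nonneg (by linarith) (by linarith)
      · exact mul_nonneg_of_nonpos_of_nonpos (by linarith) (by nlinarith [sq_nonneg v.2])
    refine le_trans ?_ (mul_le_mul_of_nonneg_right (le_max_right _ _) (by positivity))
    rw [← Real.sqrt_mul (by positivity)]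
    refine Real.sqrt_le_iff.2 ⟨by positivity, ?_⟩
    rw [mul_pow, mul_pow, div_pow, q2, Real.sq_sqrt (by positivity), ← hm, ← sr, mul_div_assoc',
      div_mul_eq_mul_div, le_div_iff₀ (by positivity)]
    rw [← sr] at hprod
    nlinarith [mul_nonneg (sq_nonneg (m - 1)) hprod]
  · refine (ENNReal.ofReal_lt_ofReal_iff q0).2 (max_lt ?_ ?_)
    · refine mul_lt_of_lt_one_right q0 ?_
      rw [Real.sqrt_lt' one_pos, one_pow, div_lt_one (by positivity)]
      linarith
    · refine mul_lt_of_lt_one_right q0 ?_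
      rw [div_lt_one (by positivity), Real.sqrt_lt' (by positivity)]
      nlinarith

end Hilbert

end KDiv

namespace KDiv

/-! ### An integral operator bounding `c_a` -/

section Operator

variable {r a : ℝ}

/-- A form of the Kantorovich inequality. -/
lemma sqrt_mul_sqrt_le_kantorovich {P Q X Y : ℝ} (hr : 0 < r) (hP : 0 ≤ P) (hQ : 0 ≤ Q)
    (hX : 0 ≤ X) (hY : 0 ≤ Y) (hXY : X ≤ r * Y) (hYX : Y ≤ r * X) :
    √(P * X ^ 2 + Q * Y ^ 2) * √(P + Q) ≤ (1 + r) / (2 * √r) * (P * X + Q * Y) := by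
  rw [← Real.sqrt_mul (by positivity)]
  refine Real.sqrt_le_iff.2 ⟨by positivity, ?_⟩
  rw [mul_pow, div_pow, mul_pow, Real.sq_sqrt hr.le, div_mul_eq_mul_div,
    le_div_iff₀ (by positivity)]
  have h : 0 ≤ P * Q * ((r * Y - X) * (r * X - Y)) :=
    mul_nonneg (mul_nonneg hP hQ) (mul_nonneg (by linarith) (by linarith))
  -- The difference of the two sides is `(r - 1)² (P X - Q Y)² + 4 P Q (r Y - X)(r X - Y)`.
  nlinarith [mul_nonneg (sq_nonneg (r - 1)) (sq_nonneg (P * X - Q * Y))]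

/-- The density of the operator from `P` to `G` that takes `1` to `(cos a, sin a)`. -/
noncomputable def hilbertDensity (r a s : ℝ) : ℝ × ℝ :=
  (Real.cos a * (1 / (1 + s) ^ 2), Real.sin a * (r / (1 + r * s) ^ 2))

/-- The weight is `(P X + Q Y) / √(P + Q)` and the norm of the density is `√(P X² + Q Y²)`, where `X
/ Y` stays in `[1/r, r]`. -/
lemma sqrt_hilbertDensity_le (hr : 1 < r) (j : Fin 2) {s : ℝ} (hs : 0 < s) :
    √((hilbertDensity r a s).1 ^ 2 + r ^ (j : ℕ) * (hilbertDensity r a s).2 ^ 2)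
      ≤ (1 + r) / (2 * √r) * hilbertWeight r a j s := by
  have hr0 : 0 < r := zero_lt_one.trans hr
  have h1 : 0 < 1 + s := by positivity
  have h2 : 0 < 1 + r * s := by positivity
  have hw := hilbertWeight_pos r a hr0 j s hs
  unfold hilbertWeight at hw ⊢
  have hD : 0 < √(Real.cos a ^ 2 / (1 + s) ^ 2
      + r ^ (2 - (j : ℕ)) * Real.sin a ^ 2 / (1 + r * s) ^ 2) := by
    refine (Real.sqrt_nonneg _).lt_of_ne fun h => ?_
    rw [← h, div_zero] at hw
    exact lt_irrefl _ hw
  rw [mul_div_assoc', le_div_iff₀ hD]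
  have hXY : 1 / (1 + s) ≤ r * (1 / (1 + r * s)) := by
    rw [mul_one_div, div_le_div_iff₀ h1 h2]
    linarith
  have hYX : 1 / (1 + r * s) ≤ r * (1 / (1 + s)) := by
    rw [mul_one_div, div_le_div_iff₀ h2 h1]
    nlinarith [mul_pos hr0 hs]
  have hYX' : 1 / (1 + r * s) ≤ 1 / (1 + s) :=
    one_div_le_one_div_of_le h1 (by nlinarith)
  have hj : j = 0 ∨ j = 1 := by omega
  rcases hj with rfl | rfl
  · have := sqrt_mul_sqrt_le_kantorovich (P := Real.cos a ^ 2 / (1 + s) ^ 2)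
      (Q := r ^ 2 * Real.sin a ^ 2 / (1 + r * s) ^ 2) hr0 (by positivity) (by positivity)
      (by positivity) (by positivity) hXY hYX
    refine le_trans (le_of_eq ?_) (this.trans (le_of_eq ?_))
    · congr 2
      simp only [hilbertDensity, Fin.val_zero]
      field_simp
    · congr 1
      field_simp
  -- Compared with `j = 0`, one factor `r` moves from `Q` to `Y`: `Q Y` is unchanged, while `Q Y²`
  -- gains the `r` of the `G₁` norm.
  · have := sqrt_mul_sqrt_le_kantorovich (P := Real.cos a ^ 2 / (1 + s) ^ 2)
      (Q := r * Real.sin a ^ 2 / (1 + r * s) ^ 2) (X := 1 / (1 + s)) (Y := r * (1 / (1 + r * s)))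
      hr0 (by positivity) (by positivity) (by positivity) (by positivity)
      (hXY.trans (le_mul_of_one_le_left (by positivity) hr.le))
      (mul_le_mul_of_nonneg_left hYX' hr0.le)
    refine le_trans (le_of_eq ?_) (this.trans (le_of_eq ?_))
    · congr 2
      · simp only [hilbertDensity, Fin.val_one]
        field_simp
      · simp
    · congr 1
      field_simp

lemma measurable_hilbertDensity_fst : Measurable fun s => (hilbertDensity r a s).1 := by
  unfold hilbertDensity
  fun_prop

lemma measurable_hilbertDensity_snd : Measurable fun s => (hilbertDensity r a s).2 := by
  unfold hilbertDensity
  fun_prop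

/-- An integrable majorant, which puts the constant function `1` in `L¹_{w₀}`. -/
lemma hilbertWeight_zero_le (hr : 1 < r) {s : ℝ} (hs : 0 < s) :
    hilbertWeight r a 0 s ≤ r * (1 / (1 + 1 * s) ^ 2) := by
  have hr0 : 0 < r := zero_lt_one.trans hr
  have h1 : 0 < 1 + s := by positivity
  have h2 : 0 < 1 + r * s := by positivity
  have hYX : 1 / (1 + r * s) ≤ 1 / (1 + s) := one_div_le_one_div_of_le h1 (by nlinarith)
  unfold hilbertWeight
  simp only [Fin.val_zero, Nat.sub_zero, one_mul]
  set p := 1 / (1 + s) with hp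
  set q := 1 / (1 + r * s) with hq
  have p0 : 0 < p := by positivity
  have q0 : 0 < q := by positivity
  set D := Real.cos a ^ 2 / (1 + s) ^ 2 + r ^ 2 * Real.sin a ^ 2 / (1 + r * s) ^ 2 with hD
  have eD : D = Real.cos a ^ 2 * p ^ 2 + r ^ 2 * Real.sin a ^ 2 * q ^ 2 := by
    rw [hD, hp, hq]; field_simp
  have D0 : 0 ≤ D := by rw [hD]; positivity
  have qp : q ^ 2 ≤ p ^ 2 := pow_le_pow_left₀ q0.le hYX 2
  have sD : √D ≤ r * p := by
    refine Real.sqrt_le_iff.2 ⟨by positivity, ?_⟩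
    have e := Real.sin_sq_add_cos_sq a
    have e1 : r ^ 2 * Real.sin a ^ 2 * q ^ 2 ≤ r ^ 2 * Real.sin a ^ 2 * p ^ 2 := by gcongr
    have e2 : Real.cos a ^ 2 * p ^ 2 ≤ r ^ 2 * (Real.cos a ^ 2 * p ^ 2) :=
      le_mul_of_one_le_left (by positivity) (one_le_pow₀ hr.le)
    calc D ≤ r ^ 2 * (Real.cos a ^ 2 * p ^ 2) + r ^ 2 * Real.sin a ^ 2 * p ^ 2 := by
          rw [eD]; linarith
      _ = r ^ 2 * p ^ 2 * (Real.sin a ^ 2 + Real.cos a ^ 2) := by ring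
      _ = (r * p) ^ 2 := by rw [e]; ring
  refine div_le_of_le_mul₀ (Real.sqrt_nonneg _) (by positivity) ?_
  calc Real.cos a ^ 2 / (1 + s) ^ 3 + r ^ 2 * Real.sin a ^ 2 / (1 + r * s) ^ 3
      = Real.cos a ^ 2 * p ^ 2 * p + r ^ 2 * Real.sin a ^ 2 * q ^ 2 * q := by
        rw [hp, hq]; field_simp
    _ ≤ Real.cos a ^ 2 * p ^ 2 * p + r ^ 2 * Real.sin a ^ 2 * q ^ 2 * p := by gcongr
    _ = √D * √D * p := by rw [Real.mul_self_sqrt D0, eD]; ring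
    _ ≤ (r * p) * √D * p := by gcongr
    _ = r * (1 / (1 + s) ^ 2) * √D := by rw [hp]; field_simp

lemma integrableOn_and_integral_div_sq {k : ℝ} (hk : 0 < k) :
    IntegrableOn (fun s : ℝ => k / (1 + k * s) ^ 2) (Ioi 0) ∧
      ∫ s in Ioi (0 : ℝ), k / (1 + k * s) ^ 2 = 1 := by
  have hderiv : ∀ s ∈ Ici (0 : ℝ),
      HasDerivAt (fun s : ℝ => -(1 + k * s)⁻¹) (k / (1 + k * s) ^ 2) s := by
    intro s hs
    have hs : 0 ≤ s := hs
    have h0 : 1 + k * s ≠ 0 := by positivity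
    have h1 : HasDerivAt (fun s : ℝ => 1 + k * s) k s := by
      simpa using ((hasDerivAt_id s).const_mul k).const_add 1
    have h2 := (h1.inv h0).neg
    rwa [neg_div, neg_neg] at h2
  have hpos : ∀ s ∈ Ioi (0 : ℝ), 0 ≤ k / (1 + k * s) ^ 2 := fun s _ => by positivity
  have hlim : Tendsto (fun s : ℝ => -(1 + k * s)⁻¹) atTop (𝓝 0) := by
    rw [← neg_zero]
    exact (tendsto_inv_atTop_zero.comp (tendsto_atTop_add_const_left _ 1
      (tendsto_id.const_mul_atTop hk))).neg
  refine ⟨integrableOn_Ioi_deriv_of_nonneg' hderiv hpos hlim, ?_⟩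
  rw [integral_Ioi_of_hasDerivAt_of_nonneg' hderiv hpos hlim]
  simp

/-- Writing the vector as a combination of fixed Euclidean vectors lets scalar integrals of the
coordinates be read as one vector-valued integral. -/
lemma enorm_pair_eq (c : ℝ) (hc : 0 ≤ c) (v : ℝ × ℝ) :
    ENNReal.ofReal (√(v.1 ^ 2 + c * v.2 ^ 2))
      = ‖v.1 • (!₂[1, 0] : EuclideanSpace ℝ (Fin 2)) + v.2 • !₂[0, √c]‖ₑ := by
  rw [enorm_sqrt_eq c hc]
  congr 1
  ext i
  fin_cases i <;> simp [mul_comm]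

lemma hilbertCouple_nrm_hilbertDensity_le (hr : 1 < r) (j : Fin 2) {s : ℝ} (hs : 0 < s) :
    (hilbertCouple r (zero_lt_one.trans hr)).nrm j (hilbertDensity r a s)
      ≤ ENNReal.ofReal ((1 + r) / (2 * √r)) * ENNReal.ofReal (hilbertWeight r a j s) := by
  rw [← ENNReal.ofReal_mul (by positivity)]
  exact ENNReal.ofReal_le_ofReal (sqrt_hilbertDensity_le hr j hs)

lemma lintegral_density_le (hr : 1 < r) (j : Fin 2)
    (h : ℝ →ₘ[(volume : Measure ℝ).restrict (Ioi 0)] ℝ) :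
    ∫⁻ s in Ioi (0 : ℝ), ‖h s‖ₑ *
        (hilbertCouple r (zero_lt_one.trans hr)).nrm j (hilbertDensity r a s)
      ≤ ENNReal.ofReal ((1 + r) / (2 * √r))
        * (weightCouple r a (zero_lt_one.trans hr)).nrm j h := by
  change _ ≤ _ * ∫⁻ s in Ioi (0 : ℝ), ‖h s‖ₑ * ENNReal.ofReal (hilbertWeight r a j s)
  rw [← lintegral_const_mul' _ _ ENNReal.ofReal_ne_top]
  refine lintegral_mono_ae ?_
  filter_upwards [ae_restrict_mem measurableSet_Ioi] with s hs
  rw [mul_left_comm]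
  gcongr
  exact hilbertCouple_nrm_hilbertDensity_le hr j hs

lemma integrable_mul_of_enorm_le {g : ℝ → ℝ} (hr : 1 < r) (j : Fin 2)
    {h : ℝ →ₘ[(volume : Measure ℝ).restrict (Ioi 0)] ℝ}
    (hh : (weightCouple r a (zero_lt_one.trans hr)).nrm j h ≠ ∞) (hg : Measurable g)
    (hle : ∀ s, ‖g s‖ₑ
      ≤ (hilbertCouple r (zero_lt_one.trans hr)).nrm j (hilbertDensity r a s)) :
    Integrable (fun s => h s * g s) ((volume : Measure ℝ).restrict (Ioi 0)) := by
  refine ⟨h.aestronglyMeasurable.mul hg.aestronglyMeasurable, ?_⟩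
  refine lt_of_le_of_lt (lintegral_mono fun s => ?_) (lt_of_le_of_lt
    (lintegral_density_le hr j h) (ENNReal.mul_lt_top ENNReal.ofReal_lt_top hh.lt_top))
  rw [enorm_mul]
  gcongr
  exact hle s

lemma enorm_fst_le (hr : 1 < r) (j : Fin 2) (v : ℝ × ℝ) :
    ‖v.1‖ₑ ≤ (hilbertCouple r (zero_lt_one.trans hr)).nrm j v := by
  have hr0 : 0 < r := zero_lt_one.trans hr
  rw [Real.enorm_eq_ofReal_abs]
  refine ENNReal.ofReal_le_ofReal (Real.abs_le_sqrt ?_)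
  have : 0 ≤ r ^ (j : ℕ) * v.2 ^ 2 := by positivity
  linarith

lemma enorm_snd_le (hr : 1 < r) (j : Fin 2) (v : ℝ × ℝ) :
    ‖v.2‖ₑ ≤ (hilbertCouple r (zero_lt_one.trans hr)).nrm j v := by
  rw [Real.enorm_eq_ofReal_abs]
  refine ENNReal.ofReal_le_ofReal (Real.abs_le_sqrt ?_)
  have : v.2 ^ 2 ≤ r ^ (j : ℕ) * v.2 ^ 2 :=
    le_mul_of_one_le_left (sq_nonneg _) (one_le_pow₀ hr.le)
  nlinarith [sq_nonneg v.1]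

lemma integrable_fst_of_nrm_ne_top (hr : 1 < r) (j : Fin 2)
    {h : ℝ →ₘ[(volume : Measure ℝ).restrict (Ioi 0)] ℝ}
    (hh : (weightCouple r a (zero_lt_one.trans hr)).nrm j h ≠ ∞) :
    Integrable (fun s => h s * (hilbertDensity r a s).1)
      ((volume : Measure ℝ).restrict (Ioi 0)) :=
  integrable_mul_of_enorm_le hr j hh measurable_hilbertDensity_fst fun _ => enorm_fst_le hr j _

lemma integrable_snd_of_nrm_ne_top (hr : 1 < r) (j : Fin 2)
    {h : ℝ →ₘ[(volume : Measure ℝ).restrict (Ioi 0)] ℝ}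
    (hh : (weightCouple r a (zero_lt_one.trans hr)).nrm j h ≠ ∞) :
    Integrable (fun s => h s * (hilbertDensity r a s).2)
      ((volume : Measure ℝ).restrict (Ioi 0)) :=
  integrable_mul_of_enorm_le hr j hh measurable_hilbertDensity_snd fun _ => enorm_snd_le hr j _

lemma integrable_of_mem_sum (hr : 1 < r)
    {h : ℝ →ₘ[(volume : Measure ℝ).restrict (Ioi 0)] ℝ}
    (hh : h ∈ (weightCouple r a (zero_lt_one.trans hr)).sum) :
    Integrable (fun s => h s * (hilbertDensity r a s).1)
        ((volume : Measure ℝ).restrict (Ioi 0)) ∧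
      Integrable (fun s => h s * (hilbertDensity r a s).2)
        ((volume : Measure ℝ).restrict (Ioi 0)) := by
  obtain ⟨x, y, rfl, hx, hy⟩ := hh
  constructor
  · refine ((integrable_fst_of_nrm_ne_top hr 0 hx).add
      (integrable_fst_of_nrm_ne_top hr 1 hy)).congr ?_
    filter_upwards [AEEqFun.coeFn_add x y] with s hs
    rw [hs, Pi.add_apply, Pi.add_apply, add_mul]
  · refine ((integrable_snd_of_nrm_ne_top hr 0 hx).add
      (integrable_snd_of_nrm_ne_top hr 1 hy)).congr ?_
    filter_upwards [AEEqFun.coeFn_add x y] with s hs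
    rw [hs, Pi.add_apply, Pi.add_apply, add_mul]

/-- The functional `h ↦ ∫ h g` on a space of functions for which these products are integrable. -/
noncomputable def integralMulLinear {μ : Measure ℝ} (S : Submodule ℝ (ℝ →ₘ[μ] ℝ)) (g : ℝ → ℝ)
    (hg : ∀ h ∈ S, Integrable (fun s => h s * g s) μ) : S →ₗ[ℝ] ℝ where
  toFun h := ∫ s, (h : ℝ →ₘ[μ] ℝ) s * g s ∂μ
  map_add' x y := by
    rw [← integral_add (hg x x.2) (hg y y.2)]
    refine integral_congr_ae ?_
    filter_upwards [AEEqFun.coeFn_add (x : ℝ →ₘ[μ] ℝ) y] with s hs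
    rw [Submodule.coe_add, hs, Pi.add_apply, add_mul]
  map_smul' c x := by
    rw [RingHom.id_apply, smul_eq_mul, ← integral_const_mul]
    refine integral_congr_ae ?_
    filter_upwards [AEEqFun.coeFn_smul c (x : ℝ →ₘ[μ] ℝ)] with s hs
    rw [Submodule.coe_smul, hs, Pi.smul_apply, smul_eq_mul, mul_assoc]

lemma mem_hilbertCouple_sum (hr : 0 < r) (v : ℝ × ℝ) : v ∈ (hilbertCouple r hr).sum :=
  ⟨v, 0, add_zero v, ENNReal.ofReal_ne_top, by simp [BanachCouple.nrm_zero]⟩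

/-- The operator `h ↦ ∫ h v` from `P` to `G` with the density `v = hilbertDensity r a`. -/
noncomputable def densityOperator (r a : ℝ) (hr : 1 < r) :
    (weightCouple r a (zero_lt_one.trans hr)).sum
      →ₗ[ℝ] (hilbertCouple r (zero_lt_one.trans hr)).sum :=
  ((integralMulLinear _ (fun s => (hilbertDensity r a s).1)
      fun _ hh => (integrable_of_mem_sum hr hh).1).prod
    (integralMulLinear _ (fun s => (hilbertDensity r a s).2)
      fun _ hh => (integrable_of_mem_sum hr hh).2)).codRestrict _
    fun _ => mem_hilbertCouple_sum _ _

lemma densityOperator_apply (hr : 1 < r)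
    (h : (weightCouple r a (zero_lt_one.trans hr)).sum) :
    (densityOperator r a hr h : ℝ × ℝ) =
      (∫ s in Ioi (0 : ℝ), (h : ℝ →ₘ[(volume : Measure ℝ).restrict (Ioi 0)] ℝ) s
          * (hilbertDensity r a s).1,
        ∫ s in Ioi (0 : ℝ), (h : ℝ →ₘ[(volume : Measure ℝ).restrict (Ioi 0)] ℝ) s
          * (hilbertDensity r a s).2) := rfl

/-- This is `‖∫ h v‖ ≤ ∫ |h| ‖v‖` in each `G_j`, followed by the pointwise bound of the density by
the weight. -/
lemma opNorm_densityOperator_le (hr : 1 < r) :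
    BanachCouple.opNorm _ _ (densityOperator r a hr) ≤ ENNReal.ofReal ((1 + r) / (2 * √r)) := by
  refine sInf_le fun j h _ => ?_
  refine le_trans ?_ (lintegral_density_le hr j _)
  obtain ⟨i₁, i₂⟩ := integrable_of_mem_sum hr h.2
  have hc : 0 ≤ r ^ (j : ℕ) := pow_nonneg (zero_lt_one.trans hr).le _
  have hn : ∀ v, (hilbertCouple r (zero_lt_one.trans hr)).nrm j v
      = ‖v.1 • (!₂[1, 0] : EuclideanSpace ℝ (Fin 2)) + v.2 • !₂[0, √(r ^ (j : ℕ))]‖ₑ :=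
    fun v => enorm_pair_eq _ hc v
  rw [hn, densityOperator_apply]
  simp only
  rw [← integral_smul_const, ← integral_smul_const,
    ← integral_add (i₁.smul_const _) (i₂.smul_const _)]
  refine (enorm_integral_le_lintegral_enorm _).trans (lintegral_mono fun s => le_of_eq ?_)
  simp only
  rw [hn, ← enorm_smul, smul_add, smul_smul, smul_smul]

lemma one_mem_weightCouple_sum (hr : 1 < r) :
    (1 : ℝ →ₘ[(volume : Measure ℝ).restrict (Ioi 0)] ℝ)
      ∈ (weightCouple r a (zero_lt_one.trans hr)).sum := by
  refine ⟨1, 0, add_zero _, ?_, by simp [BanachCouple.nrm_zero]⟩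
  have hi : Integrable (fun s : ℝ => r * (1 / (1 + 1 * s) ^ 2))
      ((volume : Measure ℝ).restrict (Ioi 0)) :=
    (integrableOn_and_integral_div_sq one_pos).1.const_mul r
  refine ne_top_of_le_ne_top hi.2.ne (lintegral_mono_ae ?_)
  filter_upwards [ae_restrict_mem measurableSet_Ioi,
    AEEqFun.coeFn_one (α := ℝ) (μ := (volume : Measure ℝ).restrict (Ioi 0)) (β := ℝ)]
    with s hs h1
  rw [h1, Pi.one_apply, enorm_one, one_mul, Real.enorm_eq_ofReal_abs]
  exact ENNReal.ofReal_le_ofReal ((hilbertWeight_zero_le hr hs).trans (le_abs_self _))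

lemma densityOperator_one (hr : 1 < r) :
    (densityOperator r a hr ⟨1, one_mem_weightCouple_sum hr⟩ : ℝ × ℝ)
      = (Real.cos a, Real.sin a) := by
  have key : ∀ {k : ℝ}, 0 < k → ∀ c : ℝ, ∫ s in Ioi (0 : ℝ),
      (1 : ℝ →ₘ[(volume : Measure ℝ).restrict (Ioi 0)] ℝ) s * (c * (k / (1 + k * s) ^ 2)) = c := by
    intro k hk c
    rw [integral_congr_ae (g := fun s => c * (k / (1 + k * s) ^ 2)), integral_const_mul,
      (integrableOn_and_integral_div_sq hk).2, mul_one]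
    filter_upwards [AEEqFun.coeFn_one (α := ℝ) (μ := (volume : Measure ℝ).restrict (Ioi 0))
      (β := ℝ)] with s h1
    rw [h1, Pi.one_apply, one_mul]
  rw [densityOperator_apply]
  refine Prod.ext ?_ (key (zero_lt_one.trans hr) _)
  have := key one_pos (Real.cos a)
  simp only [one_mul] at this
  exact this

lemma cConst_lt (hr : 1 < r) :
    cConst r a (zero_lt_one.trans hr) < ENNReal.ofReal ((1 + √r) / 2) := by
  have hr0 : 0 < r := zero_lt_one.trans hr
  have hT : densityOperator r a hr ∈ BanachCouple.operatorsTaking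
      (weightCouple r a hr0) (hilbertCouple r hr0) 1 (Real.cos a, Real.sin a) :=
    ⟨(opNorm_densityOperator_le hr).trans_lt ENNReal.ofReal_lt_top,
      one_mem_weightCouple_sum hr, densityOperator_one hr⟩
  refine ((iInf₂_le _ hT).trans (opNorm_densityOperator_le hr)).trans_lt ?_
  refine (ENNReal.ofReal_lt_ofReal_iff (by positivity)).2 ?_
  have sr : √r ^ 2 = r := Real.sq_sqrt hr0.le
  have m1 : 1 < √r := by rw [Real.lt_sqrt zero_le_one]; simpa using hr
  -- After clearing denominators the claim is `1 + r < √r + r`.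
  rw [div_lt_div_iff₀ (by positivity) two_pos]
  nlinarith

end Operator

end KDiv

theorem mainTheorem9 (r : ℝ) (hr : 1 < r) :
    (∀ a : ℝ, KDiv.cConst r a (zero_lt_one.trans hr) < ENNReal.ofReal ((1 + √r) / 2)) ∧
      (KDiv.hilbertCouple r (zero_lt_one.trans hr)).gamma <
        ENNReal.ofReal (min ((1 + √r) / 2) (√2)) := by
  refine ⟨fun _ => KDiv.cConst_lt hr, ?_⟩
  rw [ENNReal.ofReal_min]
  exact lt_min (KDiv.gamma_lt_half_one_add_sqrt hr) (KDiv.gamma_lt_sqrt_two hr)
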